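/- Let $\mathcal P=\mathbb C[x]$, let $\mathcal P^*$ be its algebraic dual, and let $q\in\mathbb C\setminus\{0\}$ satisfy $q^n\ne1$ for all integers $n\ge1$. For such a $q$ put $(H_qf)(x)=\frac{f(qx)-f(x)}{(q-1)x}$ for $f\in\mathcal P$, and for $\mathbf u\in\mathcal P^*$, $\phi\in\mathcal P$ put $\langle H_q\mathbf u,f\rangle=-\langle\mathbf u,H_qf\rangle$ and $\langle\phi\mathbf u,f\rangle=\langle\mathbf u,\phi f\rangle$. A sequence $\{p_n\}_{n\ge0}$ of polynomials is an orthogonal polynomial sequence (OPS) with respect to $\mathbf u$ if $\deg p_n=n$ and $\langle\mathbf u,p_np_m\rangle=\kappa_n\delta_{n,m}$ for all $n,m\ge0$, with all $\kappa_n\neq0$; $\mathbf u$ is regular if such a sequence exists. A regular functional $\mathbf u$ is $H_q$-semiclassical if there are nonzero polynomials $\Phi,\Psi$ with $\deg\Psi\ge1$ and $H_q(\Phi\mathbf u)=\Psi\mathbf u$; its class is the minimum of $\max\{\deg\Phi-2,\deg\Psi-1\}$ over all such pairs $(\Phi,\Psi)$. An OPS is $H_q$-semiclassical of class $s$ if it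 is an OPS with respect to an $H_q$-semiclassical functional of class $s$. The same definitions apply with $q$ replaced by $q^k$. Theorem. Let $k\ge2$ be an integer, and let $\{p_n\}_{n\ge0}$ and $\{q_n\}_{n\ge0}$ be monic OPS (each with respect to some functional) such that $p_{nk}(x)=q_n(x^k)$ for all $n\ge0$. (i) If $\{p_n\}$ is $H_q$-semiclassical of class $s$, then $\{q_n\}$ is $H_{q^k}$-semiclassical of some class $\widetilde s\le\lfloor s/k\rfloor$. (ii) If $\{q_n\}$ is $H_{q^k}$-semiclassical of class $\widetilde s$, then $\{p_n\}$ is $H_q$-semiclassical of some class $s\le(\widetilde s+3)k-3$. -/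

import Mathlib

open Polynomial

namespace HqOPS

noncomputable section

/-- The nonzero complex numbers that are not roots of unity. -/
def QTilde : Set ℂ := {z : ℂ | z ≠ 0 ∧ ∀ n : ℕ, 1 ≤ n → z ^ n ≠ 1}

/-- The dilation `f(x) ↦ f(q x)` on polynomials. -/
def dilation (q : ℂ) : ℂ[X] →ₗ[ℂ] ℂ[X] := (Polynomial.aeval (C q * X)).toLinearMap

/-- Division by `x` after removal of the constant term, `f ↦ (f(x) - f(0)) / x`, as a linear map. -/
def divXLin : ℂ[X] →ₗ[ℂ] ℂ[X] where
  toFun f := f.divX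
  map_add' f g := by ext n; simp [coeff_divX]
  map_smul' c f := by ext n; simp [coeff_divX]

/-- Hahn's operator `(H_q f)(x) = (f(q x) - f(x)) / ((q - 1) x)` on polynomials.
The numerator has no constant term, so `divXLin` is the exact division by `x`. -/
def hahn (q : ℂ) : ℂ[X] →ₗ[ℂ] ℂ[X] :=
  (q - 1)⁻¹ • (divXLin ∘ₗ (dilation q - LinearMap.id))

/-- Hahn's operator is the asserted difference quotient at every `x ≠ 0`. -/
theorem hahn_eval {q : ℂ} (hq : q ≠ 1) (f : ℂ[X]) {x : ℂ} (hx : x ≠ 0) :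
    (hahn q f).eval x = (f.eval (q * x) - f.eval x) / ((q - 1) * x) := by
  have hq' : q - 1 ≠ 0 := sub_ne_zero.mpr hq
  have hcomp : dilation q f = f.comp (C q * X) := by
    simp [dilation, Polynomial.aeval_def, Polynomial.comp]
  have h0 : (f.comp (C q * X) - f).coeff 0 = 0 := by
    simp [coeff_zero_eq_eval_zero, eval_comp]
  have h := congrArg (Polynomial.eval x) (divX_mul_X_add (f.comp (C q * X) - f))
  rw [h0] at h
  simp only [map_zero, add_zero, eval_mul, eval_X, eval_sub, eval_comp, eval_C] at h
  have h1 : (hahn q f).eval x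
      = (q - 1)⁻¹ * (f.comp (C q * X) - f).divX.eval x := by
    simp [hahn, divXLin, hcomp]
  rw [h1, ← h]
  field_simp

/-- Left multiplication of a functional by a polynomial: `⟨φ u, f⟩ = ⟨u, φ f⟩`. -/
def polyMul (φ : ℂ[X]) (u : Module.Dual ℂ ℂ[X]) : Module.Dual ℂ ℂ[X] :=
  u ∘ₗ LinearMap.mulLeft ℂ φ

/-- The `q`-derivative of a functional: `⟨H_q u, f⟩ = -⟨u, H_q f⟩`. -/
def hahnDual (q : ℂ) (u : Module.Dual ℂ ℂ[X]) : Module.Dual ℂ ℂ[X] :=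
  -(u ∘ₗ hahn q)

/-- `P` is an orthogonal polynomial sequence with respect to the functional `u`. -/
def IsOPSFor (u : Module.Dual ℂ ℂ[X]) (P : ℕ → ℂ[X]) : Prop :=
  (∀ n : ℕ, (P n).degree = n) ∧
    ∃ κ : ℕ → ℂ, (∀ n, κ n ≠ 0) ∧ ∀ n m : ℕ, u (P n * P m) = if n = m then κ n else 0

/-- A regular (quasi-definite) functional is one that admits an OPS. -/
def IsRegular (u : Module.Dual ℂ ℂ[X]) : Prop := ∃ P : ℕ → ℂ[X], IsOPSFor u P

/-- A monic orthogonal polynomial sequence (with respect to some functional). -/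
def IsMonicOPS (P : ℕ → ℂ[X]) : Prop :=
  (∀ n, (P n).Monic) ∧ ∃ u : Module.Dual ℂ ℂ[X], IsOPSFor u P

/-- The pairs `(Φ, Ψ)` of nonzero polynomials with `deg Ψ ≥ 1` and `H_q(Φ u) = Ψ u`. -/
def admissiblePairs (q : ℂ) (u : Module.Dual ℂ ℂ[X]) : Set (ℂ[X] × ℂ[X]) :=
  {F | F.1 ≠ 0 ∧ F.2 ≠ 0 ∧ 1 ≤ F.2.natDegree ∧
    hahnDual q (polyMul F.1 u) = polyMul F.2 u}

/-- `u` is an `H_q`-semiclassical functional. -/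
def IsSemiclassical (q : ℂ) (u : Module.Dual ℂ ℂ[X]) : Prop :=
  IsRegular u ∧ (admissiblePairs q u).Nonempty

/-- `u` is an `H_q`-semiclassical functional of class `s`, where `s` is the minimum of
`max {deg Φ - 2, deg Ψ - 1}` (computed in `ℤ`) over the admissible pairs. -/
def IsSemiclassicalOfClass (q : ℂ) (u : Module.Dual ℂ ℂ[X]) (s : ℕ) : Prop :=
  IsSemiclassical q u ∧
    IsLeast ((fun F : ℂ[X] × ℂ[X] => max ((F.1.natDegree : ℤ) - 2) ((F.2.natDegree : ℤ) - 1)) ''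
      admissiblePairs q u) (s : ℤ)

/-- `P` is an `H_q`-semiclassical OPS of class `s`: it is an OPS with respect to an
`H_q`-semiclassical functional of class `s`. -/
def IsSemiclassicalOPSOfClass (q : ℂ) (P : ℕ → ℂ[X]) (s : ℕ) : Prop :=
  ∃ u : Module.Dual ℂ ℂ[X], IsOPSFor u P ∧ IsSemiclassicalOfClass q u s

end

end HqOPS

/-!
The functional `v : f ↦ u (f (x ^ k))` is orthogonalised by `Q` whenever `u` is orthogonalised by
`P` (`IsOPSFor.pushforward_expand`). Since `Q n (x ^ k) = P (n * k)` is orthogonal to `x ^ i` for `i < k`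
and `n ≥ 1`, the functional `f ↦ u (x ^ i * f (x ^ k))` is a scalar multiple `c i • v`
(`apply_X_pow_mul_expand`). Writing `η = ∑ c i * x ^ (k - 1 - i)` and letting `sectionMap k` be the
`ℂ[x ^ k]`-linear map which reads off the coefficients of the `x ^ (k * m + k - 1)`, this says
`u f = v (sectionMap k (η * f))` (`apply_eq_apply_sectionMap`), that is, `u = η w` with
`w = v ∘ sectionMap k`; on Stieltjes series it is `S_u (z) = η (z) S_v (z ^ k)`.

For a regular functional, a solution of `H_q (Φ u) = Ψ u` with `Φ ≠ 0` automatically has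
`deg Ψ ≥ 1` (`mem_admissiblePairs_of_ne_zero`), because `H_q` is onto and `⟨u, Ψ⟩ = 0`.

* From `u` to `v`: multiply the equation of `u` by `x ^ i` by means of the `q`-Leibniz rule, and
  test it on polynomials in `x ^ k`. This gives an equation for `v` whose first coefficient is a
  multiple of `sectionMap k (η * x ^ (k - 1) * Φ * x ^ i)`. For some `i < k` this is nonzero, as a
  polynomial is determined by the sections of its products with `1, x, …, x ^ (k - 1)`.
* From `v` to `u`: the equation of `v` becomes
  `H_q (Φ (x ^ k) w) = [k]_q x ^ (k - 1) Ψ (x ^ k) w`; multiplying it by `η (x) η (x / q)`, whose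
  `q`-derivative is divisible by `η`, turns it into an equation for `u = η w` with first
  coefficient `η (q x) Φ (x ^ k)`.
-/

namespace HqOPS

noncomputable section

/-! ### Hahn's operator on polynomials -/

theorem dilation_eq_aeval (q : ℂ) (f : ℂ[X]) : dilation q f = aeval (C q * X) f := rfl

theorem dilation_mul (q : ℂ) (f g : ℂ[X]) :
    dilation q (f * g) = dilation q f * dilation q g := by
  simp [dilation_eq_aeval]

theorem coeff_dilation (q : ℂ) (f : ℂ[X]) (n : ℕ) :
    (dilation q f).coeff n = q ^ n * f.coeff n := by
  have h : dilation q f = f.comp (C q * X) := by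
    simp [dilation_eq_aeval, aeval_def, comp]
  rw [h, comp_C_mul_X_coeff, mul_comm]

theorem coeff_hahn (q : ℂ) (f : ℂ[X]) (n : ℕ) :
    (hahn q f).coeff n = (q - 1)⁻¹ * (q ^ (n + 1) - 1) * f.coeff (n + 1) := by
  simp only [hahn, divXLin, LinearMap.smul_apply, LinearMap.comp_apply, LinearMap.sub_apply,
    LinearMap.id_apply, LinearMap.coe_mk, AddHom.coe_mk, coeff_smul, coeff_divX, coeff_sub,
    coeff_dilation, smul_eq_mul]
  ring

theorem X_mul_hahn (q : ℂ) (f : ℂ[X]) :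
    X * hahn q f = C (q - 1)⁻¹ * (dilation q f - f) := by
  ext n
  cases n with
  | zero => simp [coeff_dilation]
  | succ n =>
    rw [coeff_X_mul, coeff_hahn, coeff_C_mul, coeff_sub, coeff_dilation]
    ring

/-- The `q`-Leibniz rule. -/
theorem hahn_mul (q : ℂ) (f g : ℂ[X]) :
    hahn q (f * g) = dilation q f * hahn q g + g * hahn q f := by
  apply mul_left_cancel₀ (X_ne_zero (R := ℂ))
  have h : X * (dilation q f * hahn q g + g * hahn q f)
      = dilation q f * (X * hahn q g) + g * (X * hahn q f) := by ring
  rw [h, X_mul_hahn, X_mul_hahn, X_mul_hahn, dilation_mul]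
  ring

theorem dilation_expand (q : ℂ) (k : ℕ) (f : ℂ[X]) :
    dilation q (expand ℂ k f) = expand ℂ k (dilation (q ^ k) f) := by
  induction f using Polynomial.induction_on' with
  | add f g hf hg => simp only [map_add, hf, hg]
  | monomial n a =>
    rw [← C_mul_X_pow_eq_monomial]
    simp only [dilation_eq_aeval, map_mul, map_pow, expand_X, expand_C, aeval_X, aeval_C,
      algebraMap_eq]
    ring

/-- The chain rule of `H_q` for the inner function `x ^ k`. -/
theorem hahn_expand (q : ℂ) {k : ℕ} (hk : 1 ≤ k) (hqk : q ^ k ≠ 1) (f : ℂ[X]) :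
    hahn q (expand ℂ k f)
      = C ((q ^ k - 1) / (q - 1)) * X ^ (k - 1) * expand ℂ k (hahn (q ^ k) f) := by
  apply mul_left_cancel₀ (X_ne_zero (R := ℂ))
  have hX : X * (C ((q ^ k - 1) / (q - 1)) * X ^ (k - 1) * expand ℂ k (hahn (q ^ k) f))
      = C ((q ^ k - 1) / (q - 1)) * expand ℂ k (X * hahn (q ^ k) f) := by
    obtain ⟨m, rfl⟩ := Nat.exists_eq_add_of_le' hk
    simp only [map_mul, expand_X, Nat.add_sub_cancel]
    ring
  have hq' : q ^ k - 1 ≠ 0 := sub_ne_zero.mpr hqk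
  rw [hX, X_mul_hahn, X_mul_hahn, dilation_expand, map_mul, expand_C, map_sub, ← mul_assoc,
    ← C_mul]
  congr 2
  field_simp

theorem natDegree_dilation_le (q : ℂ) (f : ℂ[X]) : (dilation q f).natDegree ≤ f.natDegree := by
  rw [natDegree_le_iff_coeff_eq_zero]
  intro n hn
  rw [coeff_dilation, coeff_eq_zero_of_natDegree_lt hn, mul_zero]

theorem natDegree_hahn_le (q : ℂ) (f : ℂ[X]) : (hahn q f).natDegree ≤ f.natDegree - 1 := by
  rw [natDegree_le_iff_coeff_eq_zero]
  intro n hn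
  rw [coeff_hahn, coeff_eq_zero_of_natDegree_lt (by omega), mul_zero]

theorem dilation_ne_zero {q : ℂ} (hq : q ≠ 0) {f : ℂ[X]} (hf : f ≠ 0) : dilation q f ≠ 0 := by
  obtain ⟨n, hn⟩ : ∃ n, f.coeff n ≠ 0 := by
    by_contra! h
    exact hf (Polynomial.ext (by simpa using h))
  intro h
  have := coeff_dilation q f n
  rw [h, coeff_zero] at this
  exact mul_ne_zero (pow_ne_zero n hq) hn this.symm

theorem dilation_dilation_inv {q : ℂ} (hq : q ≠ 0) (f : ℂ[X]) :
    dilation q (dilation q⁻¹ f) = f := by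
  ext n
  rw [coeff_dilation, coeff_dilation, ← mul_assoc, ← mul_pow, mul_inv_cancel₀ hq, one_pow,
    one_mul]

theorem QTilde.ne_one {q : ℂ} (hq : q ∈ QTilde) : q ≠ 1 := by
  simpa using hq.2 1 le_rfl

theorem QTilde.pow_mem {q : ℂ} (hq : q ∈ QTilde) {k : ℕ} (hk : 1 ≤ k) : q ^ k ∈ QTilde := by
  refine ⟨pow_ne_zero k hq.1, fun n hn => ?_⟩
  rw [← pow_mul]
  exact hq.2 _ (Nat.mul_pos hk hn)

theorem hahn_surjective {q : ℂ} (hq : q ∈ QTilde) : Function.Surjective (hahn q) := by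
  rw [← LinearMap.range_eq_top, Submodule.eq_top_iff']
  intro f
  induction f using Polynomial.induction_on' with
  | add f g hf hg => exact add_mem hf hg
  | monomial n a =>
    have h1 : q - 1 ≠ 0 := sub_ne_zero.mpr (QTilde.ne_one hq)
    have h2 : q ^ (n + 1) - 1 ≠ 0 := sub_ne_zero.mpr (hq.2 (n + 1) (by omega))
    refine ⟨monomial (n + 1) (a * (q - 1) / (q ^ (n + 1) - 1)), ?_⟩
    ext m
    rw [coeff_hahn, coeff_monomial, coeff_monomial]
    by_cases hm : n = m
    · subst hm
      simp only [if_true]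
      field_simp
    · rw [if_neg (by omega), if_neg hm, mul_zero]

/-! ### The section map -/

/-- The coefficient of `x ^ (k - 1)` in the expansion of a polynomial along the basis
`1, x, …, x ^ (k - 1)` of `ℂ[x]` over `ℂ[x ^ k]`, with `x ^ k` renamed `x`: the polynomial whose
coefficient of index `m` is the coefficient of index `k * m + k - 1` of the argument. The value at
`k = 0` is irrelevant. -/
def sectionMap (k : ℕ) : ℂ[X] →ₗ[ℂ] ℂ[X] where
  toFun f := (contract k (X * f)).divX
  map_add' f g := by
    rcases Nat.eq_zero_or_pos k with rfl | hk
    · ext n; simp [contract]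
    · ext n; simp [coeff_divX, coeff_contract hk.ne', mul_add]
  map_smul' c f := by
    rcases Nat.eq_zero_or_pos k with rfl | hk
    · ext n; simp [contract]
    · ext n; simp [coeff_divX, coeff_contract hk.ne']

theorem coeff_sectionMap {k : ℕ} (hk : 1 ≤ k) (f : ℂ[X]) (m : ℕ) :
    (sectionMap k f).coeff m = f.coeff (k * m + (k - 1)) := by
  have h : (m + 1) * k = k * m + (k - 1) + 1 := by
    rw [add_mul, mul_comm m k]; omega
  change ((contract k (X * f)).divX).coeff m = _
  rw [coeff_divX, coeff_contract (by omega), h, coeff_X_mul]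

theorem sectionMap_mul_expand {k : ℕ} (hk : 1 ≤ k) (f g : ℂ[X]) :
    sectionMap k (f * expand ℂ k g) = sectionMap k f * g := by
  induction g using Polynomial.induction_on' with
  | add g h hg hh => simp only [map_add, mul_add, hg, hh]
  | monomial n a =>
    ext m
    rw [← C_mul_X_pow_eq_monomial]
    have e1 : f * expand ℂ k (C a * X ^ n) = C a * (f * X ^ (n * k)) := by
      simp only [map_mul, map_pow, expand_C, expand_X]
      rw [← pow_mul, mul_comm k n]; ring
    have e2 : sectionMap k f * (C a * X ^ n) = C a * (sectionMap k f * X ^ n) := by ring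
    rw [e1, e2, coeff_sectionMap hk, coeff_C_mul, coeff_C_mul, coeff_mul_X_pow', coeff_mul_X_pow']
    by_cases hn : n ≤ m
    · obtain ⟨d, rfl⟩ := Nat.exists_eq_add_of_le hn
      have h1 : n * k ≤ k * (n + d) + (k - 1) := by nlinarith [Nat.zero_le (k * d)]
      have h2 : k * (n + d) + (k - 1) - n * k = k * d + (k - 1) := by
        rw [mul_add, mul_comm n k]; omega
      rw [if_pos h1, if_pos hn, h2, Nat.add_sub_cancel_left, coeff_sectionMap hk]
    · have h1 : ¬ n * k ≤ k * m + (k - 1) := by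
        obtain ⟨d, rfl⟩ := Nat.exists_eq_add_of_lt (not_le.mp hn)
        have : (m + d + 1) * k = k * m + k * d + k := by ring
        have := Nat.zero_le (k * d)
        omega
      rw [if_neg h1, if_neg hn]

/-- A polynomial is determined by the sections of its products with `1, x, …, x ^ (k - 1)`. -/
theorem eq_zero_of_sectionMap_mul_X_pow {k : ℕ} (hk : 1 ≤ k) {f : ℂ[X]}
    (hf : ∀ i < k, sectionMap k (f * X ^ i) = 0) : f = 0 := by
  ext n
  have hlt : n % k < k := Nat.mod_lt n (by omega)
  have h := congrArg (fun g => coeff g (n / k)) (hf (k - 1 - n % k) (by omega))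
  have hn : k * (n / k) + (k - 1) = n + (k - 1 - n % k) := by
    have := Nat.div_add_mod n k
    omega
  simpa only [coeff_sectionMap hk, hn, coeff_mul_X_pow, coeff_zero] using h

theorem natDegree_sectionMap_le {k : ℕ} (hk : 1 ≤ k) {f : ℂ[X]} {d : ℕ}
    (hf : f.natDegree ≤ k - 1 + d) : (sectionMap k f).natDegree ≤ d / k := by
  rw [natDegree_le_iff_coeff_eq_zero]
  intro m hm
  rw [coeff_sectionMap hk]
  apply coeff_eq_zero_of_natDegree_lt
  have := (Nat.div_lt_iff_lt_mul (by omega)).mp hm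
  rw [mul_comm m k] at this
  omega

/-- The section map intertwines `H_q` and `H_{q^k}`. -/
theorem sectionMap_hahn {q : ℂ} {k : ℕ} (hk : 1 ≤ k) (hqk : q ^ k ≠ 1) (f : ℂ[X]) :
    sectionMap k (hahn q f)
      = C ((q ^ k - 1) / (q - 1)) * hahn (q ^ k) (sectionMap k (f * X ^ (k - 1))) := by
  ext m
  have hq' : q ^ k - 1 ≠ 0 := sub_ne_zero.mpr hqk
  have h : k * m + (k - 1) + 1 = k * (m + 1) := by rw [mul_add]; omega
  rw [coeff_sectionMap hk, coeff_hahn, coeff_C_mul, coeff_hahn, coeff_sectionMap hk,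
    coeff_mul_X_pow, h, ← pow_mul]
  field_simp

/-! ### Orthogonality and regularity -/

/-- Polynomials `P j` of degree `j`, `j < n`, span the polynomials of degree less than `n`. -/
theorem apply_eq_zero_of_degree_lt {P : ℕ → ℂ[X]} (hP : ∀ n : ℕ, (P n).degree = n)
    (L : Module.Dual ℂ ℂ[X]) (n : ℕ) (hL : ∀ j < n, L (P j) = 0) (f : ℂ[X])
    (hf : f.degree < n) : L f = 0 := by
  induction n generalizing f with
  | zero =>
    have : f = 0 := by simpa using hf
    simp [this]
  | succ n ih =>
    have hlead : (P n).coeff n ≠ 0 := coeff_ne_zero_of_eq_degree (hP n)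
    set g := f - (f.coeff n / (P n).coeff n) • P n with hg
    have hgdeg : g.degree < n := by
      rw [degree_lt_iff_coeff_zero] at hf ⊢
      intro m hm
      rcases hm.eq_or_lt with rfl | hm
      · simp [hg, hlead]
      · have h1 : (P n).coeff m = 0 := coeff_eq_zero_of_degree_lt (by rw [hP]; exact_mod_cast hm)
        simp [hg, h1, hf m hm]
    have h := ih (fun j hj => hL j (by omega)) g hgdeg
    simpa [hg, hL n (by omega)] using h

theorem eq_zero_of_apply_eq_zero {P : ℕ → ℂ[X]} (hP : ∀ n : ℕ, (P n).degree = n)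
    {L : Module.Dual ℂ ℂ[X]} (hL : ∀ j, L (P j) = 0) : L = 0 := by
  ext1 f
  refine LinearMap.ext_ring ?_
  exact apply_eq_zero_of_degree_lt hP L (f + 1) (fun j _ => hL j) _
    ((degree_monomial_le _ _).trans_lt (by exact_mod_cast Nat.lt_succ_self f))

variable {u v : Module.Dual ℂ ℂ[X]} {P Q : ℕ → ℂ[X]}

theorem IsOPSFor.apply_mul_eq_zero (h : IsOPSFor u P) {f : ℂ[X]} {n : ℕ} (hf : f.degree < n) :
    u (f * P n) = 0 := by
  obtain ⟨hdeg, κ, -, hκ⟩ := h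
  refine apply_eq_zero_of_degree_lt hdeg (u ∘ₗ LinearMap.mulRight ℂ (P n)) n (fun j hj => ?_) f hf
  simpa [hj.ne] using hκ j n

theorem IsOPSFor.apply_eq_zero (h : IsOPSFor u P) {n : ℕ} (hn : 1 ≤ n) : u (P n) = 0 := by
  have := h.apply_mul_eq_zero (f := 1) (n := n) (by rw [degree_one]; exact_mod_cast hn)
  simpa using this

theorem IsOPSFor.apply_one_ne_zero (h : IsOPSFor u P) : u 1 ≠ 0 := by
  obtain ⟨hdeg, κ, hκ0, hκ⟩ := h
  intro h1
  have hC : P 0 * P 0 = ((P 0).coeff 0 * (P 0).coeff 0) • (1 : ℂ[X]) := by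
    have := eq_C_of_degree_eq_zero (by simpa using hdeg 0 : (P 0).degree = 0)
    rw [this]
    simp [smul_eq_C_mul]
  have h2 := hκ 0 0
  rw [hC, map_smul, h1, smul_zero, if_pos rfl] at h2
  exact hκ0 0 h2.symm

theorem IsOPSFor.smul (h : IsOPSFor u P) {c : ℂ} (hc : c ≠ 0) : IsOPSFor (c • u) P := by
  obtain ⟨hdeg, κ, hκ0, hκ⟩ := h
  refine ⟨hdeg, fun n => c * κ n, fun n => mul_ne_zero hc (hκ0 n), fun n m => ?_⟩
  simp [hκ]

theorem IsOPSFor.eq_zero_of_polyMul_eq_zero (h : IsOPSFor u P) {φ : ℂ[X]}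
    (hφ : polyMul φ u = 0) : φ = 0 := by
  by_contra hne
  obtain ⟨hdeg, κ, hκ0, hκ⟩ := id h
  set n := φ.natDegree with hn
  have hlead : (P n).coeff n ≠ 0 := coeff_ne_zero_of_eq_degree (hdeg n)
  set c := φ.coeff n / (P n).coeff n with hc
  -- Subtracting the multiple of `P n` with the same leading term lowers the degree.
  have hlow : (φ - c • P n).degree < n := by
    rw [degree_lt_iff_coeff_zero]
    intro m hm
    rcases hm.eq_or_lt with rfl | hm
    · simp [hc, hlead]
    · have h1 : (P n).coeff m = 0 :=
        coeff_eq_zero_of_degree_lt (by rw [hdeg]; exact_mod_cast hm)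
      simp [h1, coeff_eq_zero_of_natDegree_lt (hn ▸ hm)]
  have h1 := h.apply_mul_eq_zero hlow
  have h2 : u (φ * P n) = 0 := LinearMap.congr_fun hφ (P n)
  have h3 : u (P n * P n) = κ n := by simpa using hκ n n
  rw [sub_mul, map_sub, h2, smul_mul_assoc, map_smul, h3, zero_sub, neg_eq_zero,
    smul_eq_mul] at h1
  refine mul_ne_zero (div_ne_zero ?_ hlead) (hκ0 n) h1
  exact leadingCoeff_ne_zero.mpr hne

/-- Two functionals with the same orthogonal polynomials and the same value at `1` are equal. -/
theorem IsOPSFor.ext (hu : IsOPSFor u P) (hv : IsOPSFor v P) (h1 : u 1 = v 1) : u = v := by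
  rw [← sub_eq_zero]
  refine eq_zero_of_apply_eq_zero hu.1 (fun j => ?_)
  rcases Nat.eq_zero_or_pos j with rfl | hj
  · have hC := eq_C_of_degree_eq_zero (by simpa using hu.1 0 : (P 0).degree = 0)
    have hC' : P 0 = (P 0).coeff 0 • (1 : ℂ[X]) := by
      rw [smul_eq_C_mul, mul_one]; exact hC
    rw [hC', map_smul, LinearMap.sub_apply, h1, sub_self, smul_zero]
  · rw [LinearMap.sub_apply, hu.apply_eq_zero hj, hv.apply_eq_zero hj, sub_zero]

/-! ### Admissible pairs and the class -/

theorem hahnDual_polyMul_eq_iff (q : ℂ) (u : Module.Dual ℂ ℂ[X]) (Φ Ψ : ℂ[X]) :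
    hahnDual q (polyMul Φ u) = polyMul Ψ u ↔ ∀ f, u (Φ * hahn q f) = -u (Ψ * f) := by
  constructor
  · intro h f
    have := LinearMap.congr_fun h f
    change -u (Φ * hahn q f) = u (Ψ * f) at this
    rw [← this, neg_neg]
  · intro h
    refine LinearMap.ext fun f => ?_
    change -u (Φ * hahn q f) = u (Ψ * f)
    rw [h, neg_neg]

/-- The nontriviality conditions on `Ψ` follow from `Φ ≠ 0`: if `Ψ = 0`, then `Φ u` vanishes on
the range of `H_q`, which is everything; and `⟨u, Ψ⟩ = -⟨u, Φ H_q 1⟩ = 0` excludes a nonzero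
constant. -/
theorem mem_admissiblePairs_of_ne_zero {q : ℂ} (hq : q ∈ QTilde) (hu : IsOPSFor u P)
    {Φ Ψ : ℂ[X]} (hΦ : Φ ≠ 0) (h : ∀ f, u (Φ * hahn q f) = -u (Ψ * f)) :
    (Φ, Ψ) ∈ admissiblePairs q u := by
  have hΨ : Ψ ≠ 0 := by
    rintro rfl
    refine hΦ (hu.eq_zero_of_polyMul_eq_zero (LinearMap.ext fun g => ?_))
    obtain ⟨f, rfl⟩ := hahn_surjective hq g
    change u (Φ * hahn q f) = 0
    simpa using h f
  refine ⟨hΦ, hΨ, ?_, (hahnDual_polyMul_eq_iff q u Φ Ψ).mpr h⟩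
  by_contra hlt
  have hC : Ψ = Ψ.coeff 0 • (1 : ℂ[X]) := by
    rw [smul_eq_C_mul, mul_one]
    exact eq_C_of_natDegree_eq_zero (by simpa using hlt)
  have h0 : hahn q 1 = 0 := by
    ext n
    rw [coeff_hahn, coeff_one, if_neg (by omega), mul_zero, coeff_zero]
  have h1 := h 1
  rw [h0, mul_zero, map_zero, mul_one, hC, map_smul, zero_eq_neg, smul_eq_mul] at h1
  have h2 := (mul_eq_zero.mp h1).resolve_right hu.apply_one_ne_zero
  rw [h2, zero_smul] at hC
  exact hΨ hC

/-- An admissible pair bounds the class. The values minimised in the class are nonnegative, since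
`deg Ψ ≥ 1`, so that the minimum exists. -/
theorem IsOPSFor.exists_class_le {q : ℂ} (hu : IsOPSFor u P) {F : ℂ[X] × ℂ[X]}
    (hF : F ∈ admissiblePairs q u) {N : ℤ} (h1 : (F.1.natDegree : ℤ) - 2 ≤ N)
    (h2 : (F.2.natDegree : ℤ) - 1 ≤ N) :
    ∃ s : ℕ, IsSemiclassicalOPSOfClass q P s ∧ (s : ℤ) ≤ N := by
  classical
  set S := (fun F : ℂ[X] × ℂ[X] => max ((F.1.natDegree : ℤ) - 2) ((F.2.natDegree : ℤ) - 1)) ''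
    admissiblePairs q u with hS
  have hnn : ∀ z ∈ S, 0 ≤ z := by
    rintro z ⟨G, ⟨-, -, hG, -⟩, rfl⟩
    exact le_max_of_le_right (by omega)
  have hex : ∃ n : ℕ, (n : ℤ) ∈ S := by
    obtain ⟨n, hn⟩ := Int.eq_ofNat_of_zero_le (hnn _ ⟨F, hF, rfl⟩)
    exact ⟨n, F, hF, hn⟩
  have hmin : IsLeast S (Nat.find hex : ℤ) := by
    refine ⟨Nat.find_spec hex, fun z hz => ?_⟩
    obtain ⟨n, rfl⟩ := Int.eq_ofNat_of_zero_le (hnn z hz)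
    exact_mod_cast Nat.find_min' hex hz
  refine ⟨Nat.find hex, ⟨u, hu, ⟨⟨P, hu⟩, ⟨F, hF⟩⟩, hmin⟩, ?_⟩
  exact (hmin.2 ⟨F, hF, rfl⟩).trans (max_le h1 h2)

/-- A class is attained by an admissible pair. -/
theorem IsSemiclassicalOfClass.exists_pair {q : ℂ} {s : ℕ} (h : IsSemiclassicalOfClass q u s) :
    ∃ Φ Ψ : ℂ[X], Φ ≠ 0 ∧ (∀ f, u (Φ * hahn q f) = -u (Ψ * f)) ∧
      Φ.natDegree ≤ s + 2 ∧ Ψ.natDegree ≤ s + 1 := by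
  obtain ⟨-, ⟨⟨Φ, Ψ⟩, ⟨hΦ, -, -, hF⟩, hs⟩, -⟩ := h
  simp only at hs hΦ hF
  exact ⟨Φ, Ψ, hΦ, (hahnDual_polyMul_eq_iff q u Φ Ψ).mp hF, by omega, by omega⟩

/-! ### The functional of the sieved sequence -/

/-- The functional `f ↦ u (f (x ^ k))`. -/
def pushforward (k : ℕ) (u : Module.Dual ℂ ℂ[X]) : Module.Dual ℂ ℂ[X] :=
  u ∘ₗ (expand ℂ k).toLinearMap

theorem pushforward_apply (k : ℕ) (u : Module.Dual ℂ ℂ[X]) (f : ℂ[X]) :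
    pushforward k u f = u (expand ℂ k f) := rfl

theorem IsOPSFor.pushforward_expand {k : ℕ} (hk : 1 ≤ k) (hu : IsOPSFor u P)
    (hQ : ∀ n : ℕ, (Q n).degree = n) (hPQ : ∀ n, P (n * k) = expand ℂ k (Q n)) :
    IsOPSFor (pushforward k u) Q := by
  obtain ⟨-, κ, hκ0, hκ⟩ := hu
  refine ⟨hQ, fun n => κ (n * k), fun n => hκ0 _, fun n m => ?_⟩
  rw [pushforward_apply, map_mul, ← hPQ, ← hPQ, hκ]
  simp [show k ≠ 0 by omega]

/-- For `i < k` the functional `f ↦ u (x ^ i * f (x ^ k))` is a multiple of `f ↦ u (f (x ^ k))`,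
since both vanish at `Q n` for `n ≥ 1`. -/
theorem IsOPSFor.apply_X_pow_mul_expand {k : ℕ} (hu : IsOPSFor u P)
    (hQ : ∀ n : ℕ, (Q n).degree = n) (hPQ : ∀ n, P (n * k) = expand ℂ k (Q n))
    {i : ℕ} (hi : i < k) (f : ℂ[X]) :
    u (X ^ i * expand ℂ k f) = u (X ^ i) / u 1 * pushforward k u f := by
  have h1 := hu.apply_one_ne_zero
  have hL : u ∘ₗ LinearMap.mulLeft ℂ (X ^ i) ∘ₗ (expand ℂ k).toLinearMap
      - (u (X ^ i) / u 1) • pushforward k u = 0 := by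
    refine eq_zero_of_apply_eq_zero hQ fun n => ?_
    change u (X ^ i * expand ℂ k (Q n)) - u (X ^ i) / u 1 * u (expand ℂ k (Q n)) = 0
    rcases Nat.eq_zero_or_pos n with rfl | hn
    · have hC := eq_C_of_degree_eq_zero (by simpa using hQ 0 : (Q 0).degree = 0)
      rw [hC, expand_C, mul_comm, ← smul_eq_C_mul, ← mul_one (C _), ← smul_eq_C_mul, map_smul,
        map_smul, smul_eq_mul, smul_eq_mul]
      field_simp
      ring
    · have hik : i < n * k := hi.trans_le (Nat.le_mul_of_pos_left k hn)
      rw [← hPQ, hu.apply_eq_zero (by omega), mul_zero, sub_zero]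
      exact hu.apply_mul_eq_zero (by rw [degree_X_pow]; exact_mod_cast hik)
  exact sub_eq_zero.mp (LinearMap.congr_fun hL f)

/-- The polynomial `η = ∑ i < k, (u (x ^ i) / u 1) * x ^ (k - 1 - i)`, which is the ratio of the
Stieltjes series of `u` at `x` and of `f ↦ u (f (x ^ k))` at `x ^ k`. -/
def etaPoly (k : ℕ) (u : Module.Dual ℂ ℂ[X]) : ℂ[X] :=
  ∑ i ∈ Finset.range k, C (u (X ^ i) / u 1) * X ^ (k - 1 - i)

theorem natDegree_etaPoly_le (k : ℕ) (u : Module.Dual ℂ ℂ[X]) :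
    (etaPoly k u).natDegree ≤ k - 1 := by
  refine natDegree_sum_le_of_forall_le _ _ fun i _ => ?_
  exact (natDegree_C_mul_X_pow_le _ _).trans (Nat.sub_le _ _)

theorem coeff_etaPoly (k : ℕ) (u : Module.Dual ℂ ℂ[X]) {i : ℕ} (hi : i < k) :
    (etaPoly k u).coeff (k - 1 - i) = u (X ^ i) / u 1 := by
  rw [etaPoly, finsetSum_coeff, Finset.sum_eq_single_of_mem i (Finset.mem_range.mpr hi)]
  · simp
  · intro j hj hji
    rw [Finset.mem_range] at hj
    rw [coeff_C_mul_X_pow, if_neg (by omega)]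

theorem etaPoly_ne_zero {k : ℕ} (hk : 1 ≤ k) (h1 : u 1 ≠ 0) : etaPoly k u ≠ 0 := by
  intro h
  have h0 := coeff_etaPoly k u (i := 0) (by omega)
  rw [h, coeff_zero, pow_zero, div_self h1] at h0
  exact zero_ne_one h0

theorem sectionMap_etaPoly_mul_X_pow {k : ℕ} (u : Module.Dual ℂ ℂ[X]) {i : ℕ} (hi : i < k) :
    sectionMap k (etaPoly k u * X ^ i) = C (u (X ^ i) / u 1) := by
  ext m
  rw [coeff_sectionMap (by omega), coeff_C]
  rcases Nat.eq_zero_or_pos m with rfl | hm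
  · rw [coeff_mul_X_pow', if_pos (by omega), if_pos rfl, mul_zero, zero_add, coeff_etaPoly k u hi]
  · have hkm : k ≤ k * m := Nat.le_mul_of_pos_right k hm
    rw [if_neg hm.ne', coeff_mul_X_pow', if_pos (by omega)]
    have := natDegree_etaPoly_le k u
    exact coeff_eq_zero_of_natDegree_lt (by omega)

/-- The functional `u` is `η` times the composition of `f ↦ u (f (x ^ k))` with the section map. -/
theorem IsOPSFor.apply_eq_apply_sectionMap {k : ℕ} (hk : 1 ≤ k) (hu : IsOPSFor u P)
    (hQ : ∀ n : ℕ, (Q n).degree = n) (hPQ : ∀ n, P (n * k) = expand ℂ k (Q n)) (f : ℂ[X]) :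
    u f = pushforward k u (sectionMap k (etaPoly k u * f)) := by
  induction f using Polynomial.induction_on' with
  | add f g hf hg => rw [mul_add, map_add, map_add, map_add, hf, hg]
  | monomial n a =>
    have hi : n % k < k := Nat.mod_lt n (by omega)
    have hn : monomial n a = X ^ (n % k) * expand ℂ k (monomial (n / k) a) := by
      rw [expand_monomial, X_pow_mul_monomial, mul_comm, add_comm, Nat.mod_add_div]
    rw [hn, hu.apply_X_pow_mul_expand hQ hPQ hi, ← mul_assoc, sectionMap_mul_expand hk,
      sectionMap_etaPoly_mul_X_pow u hi, ← smul_eq_C_mul, map_smul, smul_eq_mul]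

/-! ### Transfer of semiclassical functionals -/

/-- From `u` to `f ↦ u (f (x ^ k))`. The bound uses `i ≤ k - 1` for the exponent of the power
`x ^ i` that multiplies the equation of `u`. -/
theorem IsOPSFor.exists_class_pushforward_le {q : ℂ} (hq : q ∈ QTilde) {k : ℕ} (hk : 1 ≤ k)
    (hu : IsOPSFor u P) (hQ : ∀ n : ℕ, (Q n).degree = n)
    (hPQ : ∀ n, P (n * k) = expand ℂ k (Q n)) {s : ℕ} (hs : IsSemiclassicalOfClass q u s) :
    ∃ t : ℕ, IsSemiclassicalOPSOfClass (q ^ k) Q t ∧ (t : ℤ) ≤ (s / k : ℕ) := by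
  obtain ⟨Φ, Ψ, hΦ, h, hdΦ, hdΨ⟩ := hs.exists_pair
  have hv := hu.pushforward_expand hk hQ hPQ
  set η := etaPoly k u with hη
  have hη0 : η ≠ 0 := etaPoly_ne_zero hk hu.apply_one_ne_zero
  have hηd : η.natDegree ≤ k - 1 := natDegree_etaPoly_le k u
  obtain ⟨i, hi, hne⟩ : ∃ i < k, sectionMap k (η * X ^ (k - 1) * Φ * X ^ i) ≠ 0 := by
    by_contra! hall
    have := eq_zero_of_sectionMap_mul_X_pow hk hall
    exact mul_ne_zero (mul_ne_zero hη0 (pow_ne_zero _ X_ne_zero)) hΦ this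
  have hq1 : q - 1 ≠ 0 := sub_ne_zero.mpr (QTilde.ne_one hq)
  have hqk : q ^ k ≠ 1 := hq.2 k hk
  have hqk1 : q ^ k - 1 ≠ 0 := sub_ne_zero.mpr hqk
  set b := (q ^ k - 1) / (q - 1) with hb
  have hb0 : b ≠ 0 := div_ne_zero hqk1 hq1
  have hXi : dilation q (X ^ i) = C (q ^ i) * X ^ i := by
    simp only [dilation_eq_aeval, map_pow, aeval_X, mul_pow]
  have key : ∀ f, pushforward k u
        (C (q ^ i * b) * sectionMap k (η * X ^ (k - 1) * Φ * X ^ i) * hahn (q ^ k) f)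
      = -pushforward k u
        (sectionMap k (η * (Ψ * X ^ i + Φ * hahn q (X ^ i))) * f) := by
    intro f
    have e1 : C (q ^ i * b) * sectionMap k (η * X ^ (k - 1) * Φ * X ^ i) * hahn (q ^ k) f
        = sectionMap k (η * (Φ * (dilation q (X ^ i) * hahn q (expand ℂ k f)))) := by
      rw [hahn_expand q hk hqk, hXi, ← hb, ← smul_eq_C_mul, ← map_smul, ← sectionMap_mul_expand hk,
        smul_eq_C_mul, C_mul]
      congr 1
      ring
    rw [e1, ← sectionMap_mul_expand hk, mul_assoc η, ← hu.apply_eq_apply_sectionMap hk hQ hPQ,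
      ← hu.apply_eq_apply_sectionMap hk hQ hPQ]
    have e2 := h (X ^ i * expand ℂ k f)
    rw [hahn_mul, mul_add, map_add] at e2
    have e3 : (Ψ * X ^ i + Φ * hahn q (X ^ i)) * expand ℂ k f
        = Ψ * (X ^ i * expand ℂ k f) + Φ * (expand ℂ k f * hahn q (X ^ i)) := by ring
    rw [e3, map_add, ← neg_eq_iff_eq_neg.mpr e2]
    ring
  have hmem := mem_admissiblePairs_of_ne_zero (QTilde.pow_mem hq hk) hv
    (mul_ne_zero (C_ne_zero.mpr (mul_ne_zero (pow_ne_zero i hq.1) hb0)) hne) key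
  have hXd : (hahn q (X ^ i)).natDegree ≤ i - 1 := by
    simpa using natDegree_hahn_le q (X ^ i)
  have hXi0 : i = 0 → hahn q (X ^ i) = 0 := by
    rintro rfl
    ext n
    rw [coeff_hahn, pow_zero, coeff_one, if_neg (by omega), mul_zero, coeff_zero]
  have d1 : (C (q ^ i * b) * sectionMap k (η * X ^ (k - 1) * Φ * X ^ i)).natDegree
      ≤ s / k + 2 := by
    refine (natDegree_C_mul_le _ _).trans ?_
    have : s / k + 2 = (s + 2 * k) / k := by
      rw [Nat.add_mul_div_right _ _ (by omega)]
    rw [this]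
    refine natDegree_sectionMap_le hk ?_
    refine natDegree_mul_le_of_le (m := k - 1 + (k - 1) + (s + 2)) (n := i)
      (natDegree_mul_le_of_le (natDegree_mul_le_of_le hηd (natDegree_X_pow_le _)) hdΦ)
      (natDegree_X_pow_le _) |>.trans ?_
    omega
  have d2 : (sectionMap k (η * (Ψ * X ^ i + Φ * hahn q (X ^ i)))).natDegree ≤ s / k + 1 := by
    have : s / k + 1 = (s + k) / k := by
      rw [Nat.add_div_right _ (by omega)]
    rw [this]
    refine natDegree_sectionMap_le hk (natDegree_mul_le_of_le hηd ?_)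
    refine natDegree_add_le_of_degree_le ?_ ?_
    · exact (natDegree_mul_le_of_le hdΨ (natDegree_X_pow_le i)).trans (by omega)
    · rcases Nat.eq_zero_or_pos i with h0 | h0
      · simp [hXi0 h0]
      · exact (natDegree_mul_le_of_le hdΦ hXd).trans (by omega)
  exact hv.exists_class_le hmem (by push_cast; omega) (by push_cast; omega)

/-- From `f ↦ u (f (x ^ k))` to `u`. -/
theorem IsOPSFor.exists_class_le_of_pushforward {q : ℂ} (hq : q ∈ QTilde) {k : ℕ} (hk : 2 ≤ k)
    (hu : IsOPSFor u P) (hQ : ∀ n : ℕ, (Q n).degree = n)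
    (hPQ : ∀ n, P (n * k) = expand ℂ k (Q n)) {t : ℕ}
    (ht : IsSemiclassicalOfClass (q ^ k) (pushforward k u) t) :
    ∃ s : ℕ, IsSemiclassicalOPSOfClass q P s ∧ (s : ℤ) ≤ ((t : ℤ) + 3) * (k : ℤ) - 3 := by
  obtain ⟨Φ, Ψ, hΦ, h, hdΦ, hdΨ⟩ := ht.exists_pair
  have hk1 : 1 ≤ k := by omega
  set η := etaPoly k u with hη
  have hη0 : η ≠ 0 := etaPoly_ne_zero hk1 hu.apply_one_ne_zero
  have hηd : η.natDegree ≤ k - 1 := natDegree_etaPoly_le k u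
  have hqk : q ^ k ≠ 1 := hq.2 k hk1
  set b := (q ^ k - 1) / (q - 1) with hb
  set η' := dilation q⁻¹ η with hη'
  have hη'd : η'.natDegree ≤ k - 1 := (natDegree_dilation_le _ _).trans hηd
  -- The equation satisfied by `f ↦ u (f (x ^ k))` composed with the section map.
  have hw : ∀ f, pushforward k u (sectionMap k (hahn q f * expand ℂ k Φ))
      = -pushforward k u (sectionMap k (C b * X ^ (k - 1) * expand ℂ k Ψ * f)) := by
    intro f
    have e1 : sectionMap k (hahn q f * expand ℂ k Φ)
        = b • (Φ * hahn (q ^ k) (sectionMap k (f * X ^ (k - 1)))) := by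
      rw [sectionMap_mul_expand hk1, sectionMap_hahn hk1 hqk, smul_eq_C_mul]
      ring
    have e2 : C b * X ^ (k - 1) * expand ℂ k Ψ * f
        = b • (f * X ^ (k - 1) * expand ℂ k Ψ) := by
      rw [smul_eq_C_mul]
      ring
    rw [e1, e2, map_smul, map_smul, map_smul, h, sectionMap_mul_expand hk1, smul_neg,
      mul_comm Ψ]
  -- Multiplication by `η * η'`, whose `q`-derivative is divisible by `η` as `η' (q x) = η (x)`.
  have hprod : hahn q (η * η') = η * (hahn q η' + hahn q η) := by
    rw [mul_comm, hahn_mul, hη', dilation_dilation_inv hq.1]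
    ring
  set B := C b * X ^ (k - 1) * expand ℂ k Ψ * η' + expand ℂ k Φ * (hahn q η' + hahn q η) with hB
  have key : ∀ f, u (dilation q η * expand ℂ k Φ * hahn q f) = -u (B * f) := by
    intro f
    have e1 := hw (η * η' * f)
    have e2 : hahn q (η * η' * f) * expand ℂ k Φ
        = η * (dilation q η * expand ℂ k Φ * hahn q f)
          + η * (expand ℂ k Φ * (hahn q η' + hahn q η) * f) := by
      rw [hahn_mul, dilation_mul, hη', dilation_dilation_inv hq.1, ← hη', hprod]
      ring
    have e3 : C b * X ^ (k - 1) * expand ℂ k Ψ * (η * η' * f)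
        = η * (C b * X ^ (k - 1) * expand ℂ k Ψ * η' * f) := by ring
    rw [e2, e3, map_add, map_add, ← hu.apply_eq_apply_sectionMap hk1 hQ hPQ,
      ← hu.apply_eq_apply_sectionMap hk1 hQ hPQ, ← hu.apply_eq_apply_sectionMap hk1 hQ hPQ] at e1
    rw [hB, add_mul, map_add, ← neg_eq_iff_eq_neg.mpr e1]
    ring
  have hmem := mem_admissiblePairs_of_ne_zero hq hu
    (mul_ne_zero (dilation_ne_zero hq.1 hη0) ((expand_ne_zero (by omega)).mpr hΦ)) key
  have hΦk : (expand ℂ k Φ).natDegree ≤ (t + 2) * k := by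
    rw [natDegree_expand]
    exact Nat.mul_le_mul_right k hdΦ
  have hΨk : (expand ℂ k Ψ).natDegree ≤ (t + 1) * k := by
    rw [natDegree_expand]
    exact Nat.mul_le_mul_right k hdΨ
  have d1 : (dilation q η * expand ℂ k Φ).natDegree ≤ k - 1 + (t + 2) * k :=
    natDegree_mul_le_of_le ((natDegree_dilation_le _ _).trans hηd) hΦk
  have d2 : B.natDegree ≤ (t + 2) * k + (k - 2) := by
    refine natDegree_add_le_of_degree_le ?_ ?_
    · refine (natDegree_mul_le_of_le
        (natDegree_mul_le_of_le (natDegree_C_mul_X_pow_le _ _) hΨk) hη'd).trans ?_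
      have : (t + 2) * k = (t + 1) * k + k := by ring
      omega
    · refine natDegree_mul_le_of_le hΦk (natDegree_add_le_of_degree_le ?_ ?_)
      · exact (natDegree_hahn_le _ _).trans (by omega)
      · exact (natDegree_hahn_le _ _).trans (by omega)
  have hN : ((t : ℤ) + 3) * (k : ℤ) = (((t + 2) * k : ℕ) : ℤ) + k := by
    push_cast
    ring
  rw [hN]
  exact hu.exists_class_le hmem (by dsimp only; omega) (by dsimp only; omega)

end

end HqOPS

theorem theorem3p5 (q : ℂ) (hq : q ∈ HqOPS.QTilde) (k : ℕ) (hk : 2 ≤ k)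
    (P Q : ℕ → Polynomial ℂ) (hP : HqOPS.IsMonicOPS P) (hQ : HqOPS.IsMonicOPS Q)
    (hPQ : ∀ n : ℕ, P (n * k) = (Q n).comp (Polynomial.X ^ k)) :
    (∀ s : ℕ, HqOPS.IsSemiclassicalOPSOfClass q P s →
      ∃ t : ℕ, HqOPS.IsSemiclassicalOPSOfClass (q ^ k) Q t ∧ t ≤ s / k) ∧
    (∀ t : ℕ, HqOPS.IsSemiclassicalOPSOfClass (q ^ k) Q t →
      ∃ s : ℕ, HqOPS.IsSemiclassicalOPSOfClass q P s ∧
        (s : ℤ) ≤ ((t : ℤ) + 3) * (k : ℤ) - 3) := by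
  have hk1 : 1 ≤ k := by omega
  obtain ⟨-, -, hQdeg, -⟩ := hQ
  obtain ⟨-, u₀, hu₀⟩ := hP
  have hPQ' : ∀ n : ℕ, P (n * k) = expand ℂ k (Q n) := fun n => by
    rw [hPQ, expand_eq_comp_X_pow]
  constructor
  · rintro s ⟨u, hu, hs⟩
    obtain ⟨t, ht, hts⟩ := hu.exists_class_pushforward_le hq hk1 hQdeg hPQ' hs
    exact ⟨t, ht, by exact_mod_cast hts⟩
  · rintro t ⟨v, hv, ht⟩
    -- Rescale the functional of `P` so that its pushforward is `v` itself.
    have hc : v 1 / u₀ 1 ≠ 0 := div_ne_zero hv.apply_one_ne_zero hu₀.apply_one_ne_zero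
    have hu := hu₀.smul hc
    have heq : HqOPS.pushforward k ((v 1 / u₀ 1) • u₀) = v := by
      refine (hu.pushforward_expand hk1 hQdeg hPQ').ext hv ?_
      rw [HqOPS.pushforward_apply, map_one (expand ℂ k), LinearMap.smul_apply, smul_eq_mul,
        div_mul_cancel₀ _ hu₀.apply_one_ne_zero]
    rw [← heq] at ht
    exact hu.exists_class_le_of_pushforward hq hk hQdeg hPQ' ht
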